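/- Write $\mathbb{D}$ for the open unit disc, $\mathbb{T}$ for the unit circle and $\mathcal{O}(\mathbb{D}^n)$ for the ring of holomorphic functions on $\mathbb{D}^n$. An inner function on $\mathbb{D}^n$ is a bounded function $f\in\mathcal{O}(\mathbb{D}^n)$ such that $\lim_{r\to1^-}|f(rw)|=1$ for almost every $w\in\mathbb{T}^n$; a rational inner function is an inner function that is rational. For a polynomial $Q(z)=\sum_\alpha a_\alpha z^\alpha\in\mathbb{C}[z_1,\dots,z_n]$ put $\widetilde{Q}(z)=\sum_\alpha\overline{a_\alpha}z^\alpha$ and $\nu(Q)=(\nu_1(Q),\dots,\nu_n(Q))$, where $\nu_j(Q)$ is the degree of $Q$ in the variable $z_j$, so that $z^{\nu(Q)}\widetilde{Q}(\frac1z)=\sum_\alpha\overline{a_\alpha}z^{\nu(Q)-\alpha}$ is a polynomial. Let $f$ be a nonconstant rational inner function on $\mathbb{D}^n$ of the form $f(z)=z^{\nu(Q)}\widetilde{Q}(\frac1z)/Q(z)$, where $Q\in\mathbb{C}[z_1,\dots,z_n]$ is a nonconstant polynomial without zeros in $\mathbb{D}^n$. Then: (a) There exist a nonconstant polynomial $\mathcal{Q}\in\mathbb{C}[z_1,\dots,z_n]$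 without zeros in $\mathbb{D}^n$ and a constant $C\in\mathbb{C}$ with $|C|=1$ such that $$f(z)=C\,\frac{z^{\nu(\mathcal{Q})}\widetilde{\mathcal{Q}}(\frac1z)}{\mathcal{Q}(z)}\qquad(z\in\mathbb{D}^n)$$ and such that the polynomials $z^{\nu(\mathcal{Q})}\widetilde{\mathcal{Q}}(\frac1z)$ and $\mathcal{Q}$ have no irreducible factor in common in $\mathbb{C}[z_1,\dots,z_n]$. (b) For every pair $(C,\mathcal{Q})$ as in (a): there exist rational inner functions $f_1,f_2$ on $\mathbb{D}^n$, both nonunits in $\mathcal{O}(\mathbb{D}^n)$, such that $f=f_1f_2$ on $\mathbb{D}^n$ if and only if $\mathcal{Q}$ is reducible in $\mathbb{C}[z_1,\dots,z_n]$, that is, a product of two nonunits (nonconstant polynomials). -/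

import Mathlib

open MeasureTheory Filter Topology MvPolynomial

/-- The open unit polydisc `𝔻ⁿ` in `ℂⁿ`. -/
def polydisc (n : ℕ) : Set (Fin n → ℂ) := {z | ∀ j, ‖z j‖ < 1}

/-- The ring `𝒪(𝔻ⁿ)` of holomorphic functions on the polydisc, as a ring of functions `𝔻ⁿ → ℂ`
with pointwise operations. -/
def holo (n : ℕ) : Subring (polydisc n → ℂ) where
  carrier := {f | ∃ F : (Fin n → ℂ) → ℂ, DifferentiableOn ℂ F (polydisc n) ∧
    ∀ z : polydisc n, f z = F z}
  mul_mem' := by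
    rintro f g ⟨F, hF, hfF⟩ ⟨G, hG, hgG⟩
    exact ⟨fun z => F z * G z, hF.mul hG, fun z => by simp [hfF z, hgG z]⟩
  one_mem' := ⟨fun _ => 1, differentiableOn_const 1, fun _ => rfl⟩
  add_mem' := by
    rintro f g ⟨F, hF, hfF⟩ ⟨G, hG, hgG⟩
    exact ⟨fun z => F z + G z, hF.add hG, fun z => by simp [hfF z, hgG z]⟩
  zero_mem' := ⟨fun _ => 0, differentiableOn_const 0, fun _ => rfl⟩
  neg_mem' := by
    rintro f ⟨F, hF, hfF⟩
    exact ⟨fun z => -F z, hF.neg, fun z => by simp [hfF z]⟩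

/-- The value `f z` for `z ∈ 𝔻ⁿ`, and `0` for `z` outside `𝔻ⁿ` (such points never matter below). -/
noncomputable def extendByZero {n : ℕ} (f : holo n) (z : Fin n → ℂ) : ℂ :=
  open Classical in if h : z ∈ polydisc n then f.1 ⟨z, h⟩ else 0

/-- The point `r w ∈ ℂⁿ`, where `w = (e^{2πi t₁}, …, e^{2πi tₙ})` is the point of the torus `𝕋ⁿ`
with the angular coordinates `t`. -/
noncomputable def radialPoint {n : ℕ} (t : UnitAddTorus (Fin n)) (r : ℝ) : Fin n → ℂ :=
  fun j => (r : ℂ) * ((t j).toCircle : ℂ)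

/-- `f` is inner: `f ∈ H^∞(𝔻ⁿ)` and `lim_{r → 1⁻} |f (r w)| = 1` for almost every `w ∈ 𝕋ⁿ`
with respect to the normalized Lebesgue (Haar) measure. -/
def IsInner {n : ℕ} (f : holo n) : Prop :=
  (∃ M : ℝ, ∀ z : polydisc n, ‖f.1 z‖ ≤ M) ∧
    ∀ᵐ t : UnitAddTorus (Fin n),
      Tendsto (fun r : ℝ => ‖extendByZero f (radialPoint t r)‖) (𝓝[<] 1) (𝓝 1)

/-- `f` is (the restriction to `𝔻ⁿ` of) a rational function. -/
def IsRationalFn {n : ℕ} (f : holo n) : Prop :=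
  ∃ P Q : MvPolynomial (Fin n) ℂ, Q ≠ 0 ∧
    ∀ z : polydisc n, eval z.1 Q ≠ 0 → f.1 z = eval z.1 P / eval z.1 Q

def IsRationalInner {n : ℕ} (f : holo n) : Prop := IsInner f ∧ IsRationalFn f

/-- `f` is nonconstant on `𝔻ⁿ`. -/
def IsNonconstantFn {n : ℕ} (f : holo n) : Prop := ¬ ∃ c : ℂ, ∀ z : polydisc n, f.1 z = c

/-- `Q` is a nonconstant polynomial. -/
def IsNonconstantPoly {n : ℕ} (Q : MvPolynomial (Fin n) ℂ) : Prop := ¬ ∃ c : ℂ, Q = C c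

/-- `Z(Q) ∩ 𝔻ⁿ = ∅`. -/
def ZeroFreeOnPolydisc {n : ℕ} (Q : MvPolynomial (Fin n) ℂ) : Prop :=
  ∀ z ∈ polydisc n, eval z Q ≠ 0

/-- `Q` is reducible in `ℂ[z₁, …, zₙ]`: a product of two nonunits. -/
def IsReduciblePoly {n : ℕ} (Q : MvPolynomial (Fin n) ℂ) : Prop :=
  ∃ q₁ q₂ : MvPolynomial (Fin n) ℂ, ¬ IsUnit q₁ ∧ ¬ IsUnit q₂ ∧ Q = q₁ * q₂

/-- The multi-index `ν(Q)`, whose `j`-th entry is the degree of `Q` in the variable `z_j`. -/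
noncomputable def multidegree {n : ℕ} (Q : MvPolynomial (Fin n) ℂ) : Fin n →₀ ℕ :=
  Finsupp.equivFunOnFinite.symm fun j => degreeOf j Q

/-- `Q̃`: the coefficients of `Q` are replaced by their complex conjugates. -/
noncomputable def conjPoly {n : ℕ} (Q : MvPolynomial (Fin n) ℂ) : MvPolynomial (Fin n) ℂ :=
  MvPolynomial.map (starRingEnd ℂ) Q

/-- The polynomial `z^{ν(Q)} Q̃(1/z) = ∑_α conj(a_α) z^{ν(Q) - α}`, for `Q = ∑_α a_α z^α`.
Here `α ≤ ν(Q)` for every `α` in the support of `Q`, so the subtraction is exact. -/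
noncomputable def reflection {n : ℕ} (Q : MvPolynomial (Fin n) ℂ) : MvPolynomial (Fin n) ℂ :=
  ∑ α ∈ Q.support, monomial (multidegree Q - α) (starRingEnd ℂ (coeff α Q))

/-- `reflection Q` is indeed `z^{ν(Q)} Q̃(1/z)` off the coordinate hyperplanes. -/
theorem eval_reflection {n : ℕ} (Q : MvPolynomial (Fin n) ℂ) (z : Fin n → ℂ)
    (hz : ∀ j, z j ≠ 0) :
    eval z (reflection Q) =
      (∏ j, z j ^ multidegree Q j) * eval (fun j => 1 / z j) (conjPoly Q) := by
  rw [conjPoly, eval_map, eval₂_eq', reflection, map_sum, Finset.mul_sum]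
  refine Finset.sum_congr rfl fun α hα => ?_
  rw [eval_monomial, Finsupp.prod_fintype _ _ (fun _ => pow_zero _), mul_left_comm,
    ← Finset.prod_mul_distrib]
  congr 1
  refine Finset.prod_congr rfl fun j _ => ?_
  have h : α j ≤ multidegree Q j := monomial_le_degreeOf j hα
  rw [Finsupp.tsub_apply, pow_sub₀ _ (hz j) h, one_div, inv_pow]

/-- `f = c z^{ν(q)} q̃(1/z) / q` on `𝔻ⁿ`, where `|c| = 1`, the polynomial `q` is nonconstant and
zero-free on `𝔻ⁿ`, and `z^{ν(q)} q̃(1/z)` and `q` have no irreducible factor in common. -/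
structure IsReducedForm {n : ℕ} (f : holo n) (c : ℂ) (q : MvPolynomial (Fin n) ℂ) : Prop where
  norm_eq_one : ‖c‖ = 1
  nonconstant : IsNonconstantPoly q
  zeroFree : ZeroFreeOnPolydisc q
  eq_on : ∀ z : polydisc n, f.1 z = c * (eval z.1 (reflection q) / eval z.1 q)
  no_common_factor : ∀ p : MvPolynomial (Fin n) ℂ, Irreducible p → p ∣ reflection q → ¬ p ∣ q

/-!
The reflection of a polynomial is multiplicative and, on polynomials that do not vanish at the
origin, an involution that preserves the multidegree. The reduced form of `f` is therefore obtained
by cancelling the greatest common divisor of `Q` and its reflection, which reflection maps to a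
unimodular multiple of itself (`exists_isReducedForm`).

Let now `f = c * reflection q / q` be in reduced form.

If `q = q₁ * q₂`, then `f` is, up to `c`, the product of the functions `reflection qᵢ / qᵢ`. The
maximum principle on the torus, where `qᵢ` and its reflection have the same modulus, bounds both
by `1` (`ZeroFreeOnPolydisc.norm_eval_reflection_le`). Their radial limits then have modulus `1`
almost everywhere because those of `f` do. If one of
the quotients were invertible, the same bound for its inverse would make it constant, so that
`reflection qᵢ` would be a multiple of `qᵢ`, against the reducedness of `q`.

Conversely, let `q` be irreducible and `f = f₁ * f₂` with rational factors. Each `fᵢ` is a quotient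
`Pᵢ / Qᵢ` of polynomials with `Qᵢ` zero-free on the polydisc
(`IsRationalFn.exists_zeroFree_denominator`), and the irreducible polynomial `reflection q` divides
`P₁ * P₂ * q = c * reflection q * Q₁ * Q₂`, but not `q`; so it divides, say, `P₁`. Then `P₂` divides
`c * Q₁ * Q₂`, whence `f₂` is invertible.
The analytic input is that relatively prime `P` and `Q` for which `P / Q`
is holomorphic cannot have a zero of `Q` in the polydisc
(`zeroFreeOnPolydisc_of_isRelPrime`): an eliminant of `P` and `Q` along a line through the zero
would vanish on an open set, by the persistence of zeros of holomorphic functions of one variable.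
-/

/-! ### Reflection of polynomials -/

section Reflection

variable {n : ℕ}

theorem eval_conjPoly (p : MvPolynomial (Fin n) ℂ) (z : Fin n → ℂ) :
    eval z (conjPoly p) = starRingEnd ℂ (eval (fun j => starRingEnd ℂ (z j)) p) := by
  have h : (eval z).comp (MvPolynomial.map (starRingEnd ℂ)) =
      (starRingEnd ℂ).comp (eval fun j => starRingEnd ℂ (z j)) :=
    MvPolynomial.ringHom_ext (by simp) (by simp)
  exact congrArg (fun φ => φ p) h

theorem eq_of_eval_eq_of_ne_zero {p q : MvPolynomial (Fin n) ℂ}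
    (h : ∀ z : Fin n → ℂ, (∀ j, z j ≠ 0) → eval z p = eval z q) : p = q :=
  funext_set (fun _ => ({0}ᶜ : Set ℂ)) (fun _ => (Set.finite_singleton 0).infinite_compl)
    fun z hz => h z fun j => hz j trivial

theorem multidegree_mul {p q : MvPolynomial (Fin n) ℂ} (hp : p ≠ 0) (hq : q ≠ 0) :
    multidegree (p * q) = multidegree p + multidegree q := by
  ext j
  exact degreeOf_mul_eq hp hq

theorem reflection_mul {p q : MvPolynomial (Fin n) ℂ} (hp : p ≠ 0) (hq : q ≠ 0) :
    reflection (p * q) = reflection p * reflection q := by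
  refine eq_of_eval_eq_of_ne_zero fun z hz => ?_
  rw [eval_mul, eval_reflection _ z hz, eval_reflection _ z hz, eval_reflection _ z hz,
    multidegree_mul hp hq]
  simp only [conjPoly, map_mul, Finsupp.add_apply, pow_add, Finset.prod_mul_distrib]
  ring

theorem degreeOf_reflection_le (p : MvPolynomial (Fin n) ℂ) (j : Fin n) :
    degreeOf j (reflection p) ≤ degreeOf j p := by
  refine (degreeOf_sum_le _ _ _).trans (Finset.sup_le fun α hα => ?_)
  rw [degreeOf_monomial_eq _ _ (by simpa using hα)]
  exact Nat.sub_le _ _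

theorem coeff_multidegree_reflection (p : MvPolynomial (Fin n) ℂ) :
    coeff (multidegree p) (reflection p) = starRingEnd ℂ (coeff 0 p) := by
  classical
  rw [reflection, coeff_sum]
  simp only [coeff_monomial]
  rw [Finset.sum_eq_single 0]
  · simp
  · intro α hα h0
    rw [if_neg]
    intro h
    apply h0
    have hle : α ≤ multidegree p := fun j => monomial_le_degreeOf j hα
    have := tsub_add_cancel_of_le hle
    rw [h] at this
    simpa using this
  · intro h
    simp [notMem_support_iff.1 h]

theorem multidegree_reflection {p : MvPolynomial (Fin n) ℂ} (h0 : coeff 0 p ≠ 0) :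
    multidegree (reflection p) = multidegree p := by
  ext j
  refine le_antisymm (degreeOf_reflection_le p j) ?_
  refine monomial_le_degreeOf (m := multidegree p) j ?_
  rw [mem_support_iff, coeff_multidegree_reflection]
  simpa using h0

theorem reflection_reflection {p : MvPolynomial (Fin n) ℂ} (h0 : coeff 0 p ≠ 0) :
    reflection (reflection p) = p := by
  refine eq_of_eval_eq_of_ne_zero fun z hz => ?_
  rw [eval_reflection _ z hz, multidegree_reflection h0, eval_conjPoly,
    eval_reflection _ _ (by simpa using hz), eval_conjPoly]
  simp only [one_div, map_inv₀, inv_inv, map_mul, map_prod, map_pow, Complex.conj_conj,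
    ← mul_assoc, ← Finset.prod_mul_distrib]
  simp [hz]

theorem reflection_ne_zero {p : MvPolynomial (Fin n) ℂ} (hp : p ≠ 0) : reflection p ≠ 0 := by
  intro h
  apply hp
  refine eq_of_eval_eq_of_ne_zero fun z hz => ?_
  have h1 := eval_reflection p (fun j => 1 / starRingEnd ℂ (z j)) (by simpa using hz)
  rw [h, eval_conjPoly] at h1
  have h2 : ∏ j, (1 / starRingEnd ℂ (z j)) ^ multidegree p j ≠ 0 :=
    Finset.prod_ne_zero_iff.2 fun j _ => pow_ne_zero _ (by simpa using hz j)
  rw [map_zero, zero_eq_mul, or_iff_right h2, map_eq_zero] at h1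
  simpa using h1

/-- On the torus `conj w = 1 / w`, so that `reflection p` at `w / r` is, up to a factor of known
modulus, the conjugate of `p` at `r w`. -/
theorem norm_eval_reflection_inv_smul (p : MvPolynomial (Fin n) ℂ) {r : ℝ} (hr : 0 < r)
    {w : Fin n → ℂ} (hw : ∀ j, ‖w j‖ = 1) :
    (∏ j, r ^ multidegree p j) * ‖eval (r⁻¹ • w) (reflection p)‖ = ‖eval (r • w) p‖ := by
  have hw0 : ∀ j, w j ≠ 0 := fun j h => by simpa [h] using hw j
  have h1 : (fun j => starRingEnd ℂ (1 / (r⁻¹ • w) j)) = r • w := by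
    ext j
    have h2 : starRingEnd ℂ (w j) = (w j)⁻¹ := (Complex.inv_eq_conj (hw j)).symm
    simp [h2, mul_comm]
  rw [eval_reflection _ _ (fun j => by simp [hr.ne', hw0 j]), eval_conjPoly, h1, norm_mul,
    RCLike.norm_conj, norm_prod, ← mul_assoc, ← Finset.prod_mul_distrib]
  simp [hw, abs_of_pos hr, hr.ne']

theorem reflection_C (c : ℂ) :
    reflection (C c : MvPolynomial (Fin n) ℂ) = C (starRingEnd ℂ c) := by
  have h : multidegree (C c : MvPolynomial (Fin n) ℂ) = 0 := Finsupp.ext fun j => degreeOf_C c j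
  refine eq_of_eval_eq_of_ne_zero fun z hz => ?_
  simp [eval_reflection _ z hz, h, conjPoly]

theorem eq_C_of_multidegree_eq_zero {p : MvPolynomial (Fin n) ℂ} (h : multidegree p = 0) :
    p = C (coeff 0 p) := by
  refine vars_eq_empty_iff_eq_C.1 (Finset.eq_empty_of_forall_notMem fun j hj => ?_)
  have h1 : degreeOf j p = 0 := DFunLike.congr_fun h j
  rw [degreeOf_def, Multiset.count_eq_zero] at h1
  exact h1 (by simpa [vars_def] using hj)

theorem isUnit_of_multidegree_eq_zero {p : MvPolynomial (Fin n) ℂ} (hp : p ≠ 0)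
    (h : multidegree p = 0) : IsUnit p := by
  have h1 := eq_C_of_multidegree_eq_zero h
  rw [h1]
  refine (IsUnit.mk0 _ fun h2 => hp ?_).map C
  rw [h1, h2, C_0]

theorem isUnit_iff_exists_C {p : MvPolynomial (Fin n) ℂ} :
    IsUnit p ↔ p ≠ 0 ∧ ∃ c, p = C c := by
  rw [isUnit_iff_eq_C_of_isReduced]
  constructor
  · rintro ⟨c, hc, rfl⟩
    exact ⟨by simpa using hc, c, rfl⟩
  · rintro ⟨h, c, rfl⟩
    exact ⟨c, by simpa using h, rfl⟩

theorem multidegree_eq_zero_of_isUnit {p : MvPolynomial (Fin n) ℂ} (h : IsUnit p) :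
    multidegree p = 0 := by
  obtain ⟨-, c, rfl⟩ := isUnit_iff_exists_C.1 h
  ext j
  exact degreeOf_C c j

/-- A factorization of `reflection q` reflects to one of `q`. A factor with constant reflection is
itself constant, because no degree is lost: the degrees of the two reflected factors already add up
to the degree of `q`. -/
theorem irreducible_reflection {q : MvPolynomial (Fin n) ℂ} (hq : Irreducible q)
    (h0 : coeff 0 q ≠ 0) : Irreducible (reflection q) := by
  have hr0 : reflection q ≠ 0 := reflection_ne_zero hq.ne_zero
  refine ⟨fun h => hq.not_isUnit ?_, fun a b hab => ?_⟩
  · refine isUnit_of_multidegree_eq_zero hq.ne_zero ?_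
    rw [← multidegree_reflection h0, multidegree_eq_zero_of_isUnit h]
  · have ha : a ≠ 0 := fun h => hr0 (by rw [hab, h, zero_mul])
    have hb : b ≠ 0 := fun h => hr0 (by rw [hab, h, mul_zero])
    have h1 : q = reflection a * reflection b := by
      rw [← reflection_mul ha hb, ← hab, reflection_reflection h0]
    have h2 : ∀ j, multidegree a j + multidegree b j =
        multidegree (reflection a) j + multidegree (reflection b) j := by
      intro j
      rw [← Finsupp.add_apply, ← Finsupp.add_apply, ← multidegree_mul ha hb, ← hab,
        multidegree_reflection h0,
        ← multidegree_mul (reflection_ne_zero ha) (reflection_ne_zero hb), ← h1]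
    have h3 : ∀ j, multidegree (reflection a) j ≤ multidegree a j := degreeOf_reflection_le a
    have h4 : ∀ j, multidegree (reflection b) j ≤ multidegree b j := degreeOf_reflection_le b
    refine (hq.isUnit_or_isUnit h1).imp (fun h => ?_) (fun h => ?_)
    · refine isUnit_of_multidegree_eq_zero ha (Finsupp.ext fun j => ?_)
      have h5 := DFunLike.congr_fun (multidegree_eq_zero_of_isUnit h) j
      have h6 := h2 j
      have h7 := h4 j
      simp only [Finsupp.coe_zero, Pi.zero_apply] at h5 ⊢
      omega
    · refine isUnit_of_multidegree_eq_zero hb (Finsupp.ext fun j => ?_)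
      have h5 := DFunLike.congr_fun (multidegree_eq_zero_of_isUnit h) j
      have h6 := h2 j
      have h7 := h3 j
      simp only [Finsupp.coe_zero, Pi.zero_apply] at h5 ⊢
      omega

end Reflection

/-! ### Coprime polynomials over a factorial ring and translation along a line -/

section Coprime

/-- By Gauss's lemma, a prime `p` that does not divide `g` is coprime to it over the fraction field,
so that the resultant of `p` and `g` does not vanish. -/
theorem exists_mul_add_mul_eq_C_of_prime {R : Type*} [CommRing R] [IsDomain R]
    [UniqueFactorizationMonoid R] {p g : Polynomial R} (hp : Prime p) (hpg : ¬ p ∣ g) :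
    ∃ u v : Polynomial R, ∃ r : R, r ≠ 0 ∧ u * p + v * g = Polynomial.C r := by
  by_cases hd : p.natDegree = 0
  · rw [Polynomial.natDegree_eq_zero] at hd
    obtain ⟨r, rfl⟩ := hd
    exact ⟨1, 0, r, fun h => hp.ne_zero (by simp [h]), by simp⟩
  have : NormalizedGCDMonoid R := Classical.choice inferInstance
  have hprim : p.IsPrimitive := hp.irreducible.isPrimitive hd
  have hirr := (hprim.irreducible_iff_irreducible_map_fraction_map
    (K := FractionRing R)).1 hp.irreducible
  have hcop : IsCoprime (p.map (algebraMap R (FractionRing R)))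
      (g.map (algebraMap R (FractionRing R))) :=
    hirr.coprime_iff_not_dvd.2 fun h =>
      hpg ((hprim.dvd_iff_fraction_map_dvd_fraction_map (FractionRing R)).2 h)
  obtain ⟨u, v, -, -, huv⟩ := Polynomial.exists_mul_add_mul_eq_C_resultant p g le_rfl le_rfl
    (Or.inl hd)
  refine ⟨u, v, _, fun h => ?_, by rw [← huv]; ring⟩
  refine Polynomial.resultant_ne_zero _ _ hcop ?_
  rw [Polynomial.natDegree_map_eq_of_injective (IsFractionRing.injective R (FractionRing R)),
    Polynomial.natDegree_map_eq_of_injective (IsFractionRing.injective R (FractionRing R)),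
    Polynomial.resultant_map_map, h, map_zero]

/-- Relatively prime polynomials over a factorial ring `R` generate an ideal that contains a nonzero
element of `R`: an elimination lemma. -/
theorem exists_mul_add_mul_eq_C_of_isRelPrime {R : Type*} [CommRing R] [IsDomain R]
    [UniqueFactorizationMonoid R] {f g : Polynomial R} (hf : f ≠ 0) (h : IsRelPrime f g) :
    ∃ u v : Polynomial R, ∃ r : R, r ≠ 0 ∧ u * f + v * g = Polynomial.C r := by
  induction f using UniqueFactorizationMonoid.induction_on_prime with
  | h₁ => exact absurd rfl hf
  | h₂ f hu =>
    obtain ⟨u, hu⟩ := hu.exists_left_inv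
    exact ⟨u, 0, 1, one_ne_zero, by simp [hu]⟩
  | h₃ f p hf0 hp ih =>
    obtain ⟨u, v, r, hr, huv⟩ := ih hf0 (h.of_dvd_left (dvd_mul_left f p))
    obtain ⟨u', v', r', hr', huv'⟩ := exists_mul_add_mul_eq_C_of_prime (g := g) hp
      fun hpg => hp.not_isUnit (h (dvd_mul_right p f) hpg)
    refine ⟨u * u', u * f * v' + v * (u' * p + v' * g), r * r', mul_ne_zero hr hr', ?_⟩
    rw [map_mul, ← huv, ← huv']
    ring

variable {σ : Type*}

/-- The substitution `g ↦ g(z + t v)`, with values in the polynomials in `t` over `ℂ[z]`. -/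
noncomputable def translateHom (v : σ → ℂ) :
    MvPolynomial σ ℂ →+* Polynomial (MvPolynomial σ ℂ) :=
  eval₂Hom (Polynomial.C.comp C) fun i => Polynomial.C (X i) + Polynomial.C (C (v i)) * Polynomial.X

/-- The automorphism `(z, t) ↦ (z + t v, t)` of `ℂ[z][t]`, which makes `translateHom v` the
composition of the inclusion `ℂ[z] → ℂ[z][t]` with an automorphism. -/
noncomputable def translateEquiv (v : σ → ℂ) :
    Polynomial (MvPolynomial σ ℂ) ≃+* Polynomial (MvPolynomial σ ℂ) :=
  RingEquiv.ofRingHom (Polynomial.eval₂RingHom (translateHom v) Polynomial.X)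
    (Polynomial.eval₂RingHom (translateHom (-v)) Polynomial.X)
    (by
      refine Polynomial.ringHom_ext' (MvPolynomial.ringHom_ext ?_ ?_) ?_ <;>
        simp [translateHom, add_assoc, ← add_mul])
    (by
      refine Polynomial.ringHom_ext' (MvPolynomial.ringHom_ext ?_ ?_) ?_ <;>
        simp [translateHom, add_assoc, ← add_mul])

theorem translateEquiv_C (v : σ → ℂ) (g : MvPolynomial σ ℂ) :
    translateEquiv v (Polynomial.C g) = translateHom v g := by
  simp [translateEquiv]

theorem eval_eval_translateHom (v z : σ → ℂ) (t : ℂ) (g : MvPolynomial σ ℂ) :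
    Polynomial.eval t ((translateHom v g).map (eval z)) = eval (z + t • v) g := by
  have h : ((Polynomial.evalRingHom t).comp ((Polynomial.mapRingHom (eval z)).comp
      (translateHom v))) = eval (z + t • v) := by
    refine MvPolynomial.ringHom_ext ?_ ?_ <;> simp [translateHom, mul_comm t]
  simpa using congrArg (fun φ => φ g) h

theorem IsRelPrime.polynomial_C {R : Type*} [CommRing R] [IsDomain R] {a b : R} (ha : a ≠ 0)
    (h : IsRelPrime a b) : IsRelPrime (Polynomial.C a) (Polynomial.C b) := by
  intro d hda hdb
  have hd : d.natDegree = 0 := by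
    simpa using Polynomial.natDegree_le_of_dvd hda (by simpa using ha)
  obtain ⟨d, rfl⟩ := Polynomial.natDegree_eq_zero.1 hd
  rw [Polynomial.C_dvd_iff_dvd_coeff] at hda hdb
  exact (h (by simpa using hda 0) (by simpa using hdb 0)).map Polynomial.C

theorem IsRelPrime.translateHom {p q : MvPolynomial σ ℂ} (hq : q ≠ 0) (h : IsRelPrime q p)
    (v : σ → ℂ) : IsRelPrime (translateHom v q) (translateHom v p) := by
  intro d hdq hdp
  rw [← translateEquiv_C] at hdq hdp
  have h1 := h.polynomial_C hq (d := (translateEquiv v).symm d)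
    (by simpa using map_dvd (translateEquiv v).symm hdq)
    (by simpa using map_dvd (translateEquiv v).symm hdp)
  simpa using h1.map (translateEquiv v)

/-- Elimination along the direction `v`: relatively prime `q` and `p` that vanish at a common point
of the line `z + ℂ v` make the nonzero polynomial `r` vanish at `z`. -/
theorem exists_eliminant {p q : MvPolynomial σ ℂ} (hq : q ≠ 0) (h : IsRelPrime q p) (v : σ → ℂ) :
    ∃ r : MvPolynomial σ ℂ, r ≠ 0 ∧ ∀ (z : σ → ℂ) (t : ℂ),
      eval (z + t • v) q = 0 → eval (z + t • v) p = 0 → eval z r = 0 := by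
  have hq' : translateHom v q ≠ 0 := by
    rw [← translateEquiv_C]
    simpa using hq
  obtain ⟨a, b, r, hr, hab⟩ := exists_mul_add_mul_eq_C_of_isRelPrime hq' (h.translateHom hq v)
  refine ⟨r, hr, fun z t h1 h2 => ?_⟩
  have h3 := congrArg (fun F => Polynomial.eval t (Polynomial.map (eval z) F)) hab
  simpa [eval_eval_translateHom, h1, h2, eq_comm] using h3

end Coprime

/-! ### The modulus of the reflection on the polydisc -/

section Modulus

variable {n : ℕ}

theorem polydisc_eq_ball (n : ℕ) : polydisc n = Metric.ball 0 1 := by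
  ext z
  simp [polydisc, pi_norm_lt_iff]

theorem isOpen_polydisc (n : ℕ) : IsOpen (polydisc n) := by
  rw [polydisc_eq_ball]
  exact Metric.isOpen_ball

theorem zero_mem_polydisc (n : ℕ) : (0 : Fin n → ℂ) ∈ polydisc n := fun _ => by simp

theorem differentiable_eval (p : MvPolynomial (Fin n) ℂ) :
    Differentiable ℂ fun z : Fin n → ℂ => eval z p := by
  induction p using MvPolynomial.induction_on with
  | C a => simp
  | add p q hp hq =>
    simp only [map_add]
    exact hp.add hq
  | mul_X p j hp =>
    simp only [map_mul, eval_X]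
    exact hp.mul (differentiable_apply j)

theorem ZeroFreeOnPolydisc.differentiableOn_eval_div {q : MvPolynomial (Fin n) ℂ}
    (hq : ZeroFreeOnPolydisc q) (p : MvPolynomial (Fin n) ℂ) :
    DifferentiableOn ℂ (fun z => eval z p / eval z q) (polydisc n) := by
  have hp' := (differentiable_eval p).differentiableOn (s := polydisc n)
  have hq' := (differentiable_eval q).differentiableOn (s := polydisc n)
  simp only [div_eq_mul_inv]
  exact hp'.mul (hq'.inv hq)

theorem eq_zero_of_eventually_eval_eq_zero {p : MvPolynomial (Fin n) ℂ} {a : Fin n → ℂ}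
    (h : ∀ᶠ z in 𝓝 a, eval z p = 0) : p = 0 := by
  obtain ⟨δ, hδ, hball⟩ := Metric.eventually_nhds_iff_ball.1 h
  refine funext_set (fun j => Metric.ball (a j) δ)
    (fun j => (infinite_of_mem_nhds (a j) (Metric.ball_mem_nhds _ hδ))) fun z hz => ?_
  rw [map_zero]
  rw [← ball_pi _ hδ] at hz
  exact hball z hz

theorem eq_of_eval_eq_on_polydisc {p q : MvPolynomial (Fin n) ℂ}
    (h : ∀ z ∈ polydisc n, eval z p = eval z q) : p = q := by
  refine sub_eq_zero.1 (eq_zero_of_eventually_eval_eq_zero (a := 0) ?_)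
  filter_upwards [(isOpen_polydisc n).mem_nhds (zero_mem_polydisc n)] with z hz
  rw [map_sub, h z hz, sub_self]

theorem ZeroFreeOnPolydisc.coeff_zero_ne_zero {p : MvPolynomial (Fin n) ℂ}
    (hp : ZeroFreeOnPolydisc p) : coeff 0 p ≠ 0 := by
  have h := hp 0 (zero_mem_polydisc n)
  rwa [← constantCoeff_eq, ← eval_zero]

theorem ZeroFreeOnPolydisc.ne_zero {p : MvPolynomial (Fin n) ℂ}
    (hp : ZeroFreeOnPolydisc p) : p ≠ 0 :=
  fun h => hp.coeff_zero_ne_zero (by simp [h])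

theorem ZeroFreeOnPolydisc.of_dvd {p q : MvPolynomial (Fin n) ℂ} (hq : ZeroFreeOnPolydisc q)
    (h : p ∣ q) : ZeroFreeOnPolydisc p := by
  obtain ⟨s, rfl⟩ := h
  exact fun z hz h0 => hq z hz (by rw [map_mul, h0, zero_mul])

/-- Maximum modulus principle with the torus (the distinguished boundary) in place of the
topological boundary, obtained by moving one coordinate at a time to the unit circle. -/
theorem norm_le_of_forall_torus_norm_le {F : (Fin n → ℂ) → ℂ} {M : ℝ}
    (hF : ∀ z : Fin n → ℂ, (∀ j, ‖z j‖ ≤ 1) → DifferentiableAt ℂ F z)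
    (hM : ∀ w : Fin n → ℂ, (∀ j, ‖w j‖ = 1) → ‖F w‖ ≤ M) {z : Fin n → ℂ}
    (hz : ∀ j, ‖z j‖ ≤ 1) : ‖F z‖ ≤ M := by
  suffices H : ∀ (S : Finset (Fin n)) (z : Fin n → ℂ), (∀ j, ‖z j‖ ≤ 1) →
      (∀ j ∉ S, ‖z j‖ = 1) → ‖F z‖ ≤ M from H Finset.univ z hz (by simp)
  intro S
  induction S using Finset.induction_on with
  | empty => exact fun z _ hz => hM z (by simpa using hz)
  | insert a S _ ih =>
    intro z hz hzS
    have hle : ∀ t : ℂ, ‖t‖ ≤ 1 → ∀ j, ‖Function.update z a t j‖ ≤ 1 := by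
      intro t ht j
      by_cases hj : j = a
      · subst hj
        simpa using ht
      · simpa [hj] using hz j
    have hd : DifferentiableOn ℂ (fun t => F (Function.update z a t))
        (closure (Metric.ball 0 1)) := by
      rw [closure_ball _ one_ne_zero]
      intro t ht
      exact ((hF _ (hle t (by simpa using ht))).comp t
        (hasFDerivAt_update z t).differentiableAt).differentiableWithinAt
    have h := Complex.norm_le_of_forall_mem_frontier_norm_le Metric.isBounded_ball
      hd.diffContOnCl (C := M) ?_ (z := z a) ?_
    · simpa using h
    · intro t ht
      rw [frontier_ball _ one_ne_zero, mem_sphere_zero_iff_norm] at ht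
      refine ih _ (hle t ht.le) fun j hj => ?_
      by_cases hja : j = a
      · subst hja
        simpa using ht
      · simpa [hja] using hzS j (by simp [hja, hj])
    · rw [closure_ball _ one_ne_zero]
      simpa using hz a

/-- The quotient `reflection p / p` is bounded by `1`: this follows from the maximum principle for
the quotients `r ^ |ν| * reflection p (z / r) / p (r z)`, which are holomorphic near the closed
polydisc and unimodular on the torus, upon letting `r → 1`. -/
theorem ZeroFreeOnPolydisc.norm_eval_reflection_le {p : MvPolynomial (Fin n) ℂ}
    (hp : ZeroFreeOnPolydisc p) {z : Fin n → ℂ} (hz : z ∈ polydisc n) :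
    ‖eval z (reflection p)‖ ≤ ‖eval z p‖ := by
  have key : ∀ r : ℝ, 0 < r → r < 1 →
      (∏ j, r ^ multidegree p j) * ‖eval (r⁻¹ • z) (reflection p)‖ ≤ ‖eval (r • z) p‖ := by
    intro r hr hr1
    have hmem : ∀ w : Fin n → ℂ, (∀ j, ‖w j‖ ≤ 1) → eval (r • w) p ≠ 0 := by
      intro w hw
      refine hp _ fun j => ?_
      have h1 : r * ‖w j‖ ≤ r * 1 := mul_le_mul_of_nonneg_left (hw j) hr.le
      simp only [Pi.smul_apply, norm_smul, Real.norm_eq_abs, abs_of_pos hr]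
      linarith
    have h1 := norm_le_of_forall_torus_norm_le
      (F := fun w => eval (r⁻¹ • w) (reflection p) / eval (r • w) p)
      (M := (∏ j, r ^ multidegree p j)⁻¹) ?_ ?_ (z := z) (fun j => (hz j).le)
    · rw [norm_div, div_le_iff₀ (norm_pos_iff.2 (hmem z fun j => (hz j).le))] at h1
      have hpos : 0 < ∏ j, r ^ multidegree p j := Finset.prod_pos fun j _ => pow_pos hr _
      rwa [inv_mul_eq_div, le_div_iff₀ hpos, mul_comm] at h1
    · intro w hw
      have hd : ∀ (g : MvPolynomial (Fin n) ℂ) (s : ℝ),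
          Differentiable ℂ fun w : Fin n → ℂ => eval (s • w) g := fun g s =>
        (differentiable_eval g).comp (differentiable_id.const_smul s)
      simp only [div_eq_mul_inv]
      exact (hd (reflection p) r⁻¹ w).mul ((hd p r w).inv (hmem w hw))
    · intro w hw
      have h2 := norm_eval_reflection_inv_smul p hr hw
      have h3 := norm_pos_iff.2 (hmem w fun j => (hw j).le)
      have hpos : 0 < ∏ j, r ^ multidegree p j := Finset.prod_pos fun j _ => pow_pos hr _
      rw [norm_div, div_le_iff₀ h3, ← h2, inv_mul_cancel_left₀ hpos.ne']
  have hl : Tendsto (fun r : ℝ => (∏ j, r ^ multidegree p j) * ‖eval (r⁻¹ • z) (reflection p)‖)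
      (𝓝[<] 1) (𝓝 ‖eval z (reflection p)‖) := by
    have h : ContinuousAt (fun r : ℝ =>
        (∏ j, r ^ multidegree p j) * ‖eval (r⁻¹ • z) (reflection p)‖) 1 := by
      refine ContinuousAt.mul (by fun_prop) (ContinuousAt.norm ?_)
      exact ContinuousAt.comp (g := fun w => eval w (reflection p))
        (continuous_eval (reflection p)).continuousAt
        ((continuousAt_inv₀ one_ne_zero).smul continuousAt_const)
    simpa using h.tendsto.mono_left nhdsWithin_le_nhds
  have hr : Tendsto (fun r : ℝ => ‖eval (r • z) p‖) (𝓝[<] 1) (𝓝 ‖eval z p‖) := by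
    have h : ContinuousAt (fun r : ℝ => ‖eval (r • z) p‖) 1 :=
      ((continuous_eval p).comp (continuous_id.smul continuous_const)).norm.continuousAt
    simpa using h.tendsto.mono_left nhdsWithin_le_nhds
  refine le_of_tendsto_of_tendsto hl hr ?_
  filter_upwards [Ioo_mem_nhdsLT (zero_lt_one (α := ℝ))] with r hr using key r hr.1 hr.2

/-- If neither `p` nor its reflection vanishes in the polydisc, then each is bounded by the other,
so their quotient has constant modulus. -/
theorem ZeroFreeOnPolydisc.exists_reflection_eq_C_mul {p : MvPolynomial (Fin n) ℂ}
    (hp : ZeroFreeOnPolydisc p) (hr : ZeroFreeOnPolydisc (reflection p)) :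
    ∃ c, reflection p = C c * p := by
  have hnorm : ∀ z ∈ polydisc n, ‖eval z (reflection p) / eval z p‖ = 1 := by
    intro z hz
    have h1 := hr.norm_eval_reflection_le hz
    rw [reflection_reflection hp.coeff_zero_ne_zero] at h1
    rw [norm_div, le_antisymm (hp.norm_eval_reflection_le hz) h1,
      div_self (norm_ne_zero_iff.2 (hp z hz))]
  have hconst := Complex.eqOn_of_isPreconnected_of_isMaxOn_norm
    (f := fun z => eval z (reflection p) / eval z p) (U := polydisc n) (c := 0)
    (by rw [polydisc_eq_ball]; exact (convex_ball _ _).isPreconnected) (isOpen_polydisc n)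
    (hp.differentiableOn_eval_div _) (zero_mem_polydisc n)
    (fun z hz => by
      simp only [Function.comp_apply, Set.mem_ofPred_eq]
      rw [hnorm z hz, hnorm 0 (zero_mem_polydisc n)])
  refine ⟨eval 0 (reflection p) / eval 0 p, eq_of_eval_eq_on_polydisc fun z hz => ?_⟩
  rw [map_mul, eval_C]
  exact (div_eq_iff (hp z hz)).1 (hconst hz)

end Modulus

/-! ### Denominators of holomorphic rational functions -/

section Denominators

variable {n : ℕ}

/-- Minimum modulus principle: a holomorphic function that is larger on a circle than at the
centre vanishes inside. -/
theorem exists_eq_zero_of_norm_lt_on_sphere {g : ℂ → ℂ} (hg : Differentiable ℂ g) {ε : ℝ}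
    (hε : 0 < ε) (h : ∀ t ∈ Metric.sphere (0 : ℂ) ε, ‖g 0‖ < ‖g t‖) :
    ∃ t ∈ Metric.closedBall (0 : ℂ) ε, g t = 0 := by
  by_contra! hne
  have hd : DifferentiableOn ℂ (fun t => (g t)⁻¹) (closure (Metric.ball 0 ε)) := by
    rw [closure_ball _ hε.ne']
    exact hg.differentiableOn.inv hne
  obtain ⟨t, ht, hmax⟩ := Complex.exists_mem_frontier_isMaxOn_norm Metric.isBounded_ball
    (Metric.nonempty_ball.2 hε) hd.diffContOnCl
  rw [frontier_ball _ hε.ne'] at ht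
  have h0 : (0 : ℂ) ∈ closure (Metric.ball 0 ε) := subset_closure (Metric.mem_ball_self hε)
  have h1 : ‖(g 0)⁻¹‖ ≤ ‖(g t)⁻¹‖ := hmax h0
  rw [norm_inv, norm_inv] at h1
  have h2 : 0 < ‖g 0‖ := norm_pos_iff.2 (hne 0 (Metric.mem_closedBall_self hε.le))
  exact absurd ((inv_le_inv₀ h2 (h2.trans (h t ht))).1 h1) (h t ht).not_ge

/-- Two relatively prime polynomials cannot be such that each zero of `q` in the polydisc is a zero
of `p`, unless `q` has none there. Otherwise, near a zero `a` of `q`, every line parallel to a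
suitable direction `v` still meets the zero set of `q`, and hence the common zeros of `p` and `q`;
so an eliminant along `v` would vanish near `a`. -/
theorem zeroFreeOnPolydisc_of_isRelPrime {p q : MvPolynomial (Fin n) ℂ} (hq : q ≠ 0)
    (hrel : IsRelPrime q p) (hpq : ∀ z ∈ polydisc n, eval z q = 0 → eval z p = 0) :
    ZeroFreeOnPolydisc q := by
  intro a ha hqa
  obtain ⟨b, hb⟩ : ∃ b, eval b q ≠ 0 := by
    by_contra! h
    exact hq (MvPolynomial.funext fun z => by rw [h z, map_zero])
  obtain ⟨r, hr, hrz⟩ := exists_eliminant hq hrel (b - a)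
  refine hr (eq_zero_of_eventually_eval_eq_zero (a := a) ?_)
  set v := b - a with hv
  have hdiff : ∀ z, Differentiable ℂ fun t : ℂ => eval (z + t • v) q := fun z =>
    (differentiable_eval q).comp ((differentiable_id.smul_const v).const_add z)
  have hcont : Continuous fun y : (Fin n → ℂ) × ℂ => y.1 + y.2 • v := by fun_prop
  have hisol : ∀ᶠ t in 𝓝[≠] (0 : ℂ), eval (a + t • v) q ≠ 0 := by
    have han : AnalyticOnNhd ℂ (fun t : ℂ => eval (a + t • v) q) Set.univ :=
      (hdiff a).differentiableOn.analyticOnNhd isOpen_univ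
    refine (han 0 trivial).eventually_eq_zero_or_eventually_ne_zero.resolve_left fun h => hb ?_
    simpa [hv] using han.eqOn_zero_of_preconnected_of_eventuallyEq_zero isPreconnected_univ
      trivial h (Set.mem_univ 1)
  have hpoly : ∀ᶠ t in 𝓝 (0 : ℂ), a + t • v ∈ polydisc n :=
    (Continuous.continuousAt (by fun_prop : Continuous fun t : ℂ => a + t • v)).eventually_mem
      ((isOpen_polydisc n).mem_nhds (by simpa using ha))
  obtain ⟨δ, hδ, hball⟩ := Metric.eventually_nhds_iff.1
    ((eventually_nhdsWithin_iff.1 hisol).and hpoly)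
  have hδ2 : δ / 2 < δ := half_lt_self hδ
  have h1 : ∀ᶠ z in 𝓝 a, ∀ t ∈ Metric.sphere (0 : ℂ) (δ / 2),
      ‖eval z q‖ < ‖eval (z + t • v) q‖ := by
    refine (isCompact_sphere _ _).eventually_forall_of_forall_eventually fun t ht => ?_
    have ht' : dist t 0 = δ / 2 := ht
    have ht0 : t ≠ 0 := by
      rintro rfl
      simp at ht'
      linarith
    refine ContinuousAt.eventually_lt (f := fun y : (Fin n → ℂ) × ℂ => ‖eval y.1 q‖)
      (((continuous_eval q).comp continuous_fst).norm.continuousAt)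
      (((continuous_eval q).comp hcont).norm.continuousAt) ?_
    simpa [hqa] using (hball (ht'.trans_lt hδ2)).1 ht0
  have h2 : ∀ᶠ z in 𝓝 a, ∀ t ∈ Metric.closedBall (0 : ℂ) (δ / 2), z + t • v ∈ polydisc n := by
    refine (isCompact_closedBall _ _).eventually_forall_of_forall_eventually fun t ht => ?_
    exact hcont.continuousAt.eventually_mem
      ((isOpen_polydisc n).mem_nhds (hball (lt_of_le_of_lt ht hδ2)).2)
  filter_upwards [h1, h2] with z hz1 hz2
  obtain ⟨t, ht, hqt⟩ := exists_eq_zero_of_norm_lt_on_sphere (hdiff z) (half_pos hδ)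
    (by simpa using hz1)
  exact hrz z t hqt (hpq _ (hz2 t ht) hqt)

/-- A rational function that is holomorphic on the polydisc has, in lowest terms, a denominator
without zeros there. -/
theorem IsRationalFn.exists_zeroFree_denominator {f : holo n} (hf : IsRationalFn f) :
    ∃ P Q : MvPolynomial (Fin n) ℂ, ZeroFreeOnPolydisc Q ∧
      ∀ z : polydisc n, f.1 z * eval z.1 Q = eval z.1 P := by
  obtain ⟨P, Q, hQ, hfPQ⟩ := hf
  obtain ⟨Q', P', d, hrel, rfl, rfl⟩ := UniqueFactorizationMonoid.exists_reduced_factors Q hQ P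
  obtain ⟨F, hF, hfF⟩ := f.2
  have heq : ∀ z ∈ polydisc n, F z * eval z Q' = eval z P' := by
    intro z hz
    -- If this failed at `z`, it would fail near `z`, where `d * Q'` is not identically zero.
    by_contra hne
    have hcont : ContinuousAt (fun z => F z * eval z Q') z :=
      (hF.continuousOn.continuousAt ((isOpen_polydisc n).mem_nhds hz)).mul
        (continuous_eval Q').continuousAt
    have hev := (hcont.ne_iff_eventually_ne (continuous_eval P').continuousAt).1 hne
    refine hQ (eq_zero_of_eventually_eval_eq_zero (a := z) ?_)
    filter_upwards [hev, (isOpen_polydisc n).mem_nhds hz] with w hw hwmem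
    by_contra h0
    apply hw
    have h1 := hfPQ ⟨w, hwmem⟩ h0
    rw [hfF] at h1
    rw [map_mul] at h0
    rw [h1, map_mul, map_mul, mul_div_mul_left _ _ (left_ne_zero_of_mul h0),
      div_mul_cancel₀ _ (right_ne_zero_of_mul h0)]
  refine ⟨P', Q', ?_, fun z => by rw [hfF, heq z.1 z.2]⟩
  refine zeroFreeOnPolydisc_of_isRelPrime (right_ne_zero_of_mul hQ) hrel fun z hz h0 => ?_
  rw [← heq z hz, h0, mul_zero]

end Denominators

/-! ### Factorizations of inner functions -/

section Inner

variable {n : ℕ}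

/-- The quotient `P / Q` of polynomials as a holomorphic function on the polydisc, for `Q` without
zeros there. -/
noncomputable def quotientHolo (P Q : MvPolynomial (Fin n) ℂ) (hQ : ZeroFreeOnPolydisc Q) :
    holo n :=
  ⟨fun z => eval z.1 P / eval z.1 Q, fun z => eval z P / eval z Q,
    hQ.differentiableOn_eval_div P, fun _ => rfl⟩

theorem isRationalFn_quotientHolo (P Q : MvPolynomial (Fin n) ℂ) (hQ : ZeroFreeOnPolydisc Q) :
    IsRationalFn (quotientHolo P Q hQ) :=
  ⟨P, Q, hQ.ne_zero, fun _ _ => rfl⟩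

theorem ne_zero_of_isUnit {f : holo n} (hf : IsUnit f) (z : polydisc n) : f.1 z ≠ 0 := by
  obtain ⟨g, hg⟩ := hf.exists_right_inv
  intro h
  have h1 : f.1 z * g.1 z = 1 := congrFun (congrArg Subtype.val hg) z
  simp [h] at h1

theorem isUnit_of_mul_eval_eq {f : holo n} {P Q : MvPolynomial (Fin n) ℂ}
    (hP : ZeroFreeOnPolydisc P) (h : ∀ z : polydisc n, f.1 z * eval z.1 Q = eval z.1 P) :
    IsUnit f := by
  refine IsUnit.of_mul_eq_one (quotientHolo Q P hP) (Subtype.ext (funext fun z => ?_))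
  change f.1 z * (eval z.1 Q / eval z.1 P) = 1
  rw [← mul_div_assoc, h, div_self (hP z.1 z.2)]

theorem radialPoint_mem_polydisc (t : UnitAddTorus (Fin n)) {r : ℝ} (hr : r ∈ Set.Ioo (0 : ℝ) 1) :
    radialPoint t r ∈ polydisc n := by
  intro j
  rw [radialPoint, norm_mul, Circle.norm_coe, mul_one, Complex.norm_real,
    Real.norm_of_nonneg hr.1.le]
  exact hr.2

/-- By `‖f₁ f₂‖ ≤ ‖f₁‖ ≤ 1`, the radial limits of `‖f₁‖` are squeezed to `1`. -/
theorem isInner_left_of_mul {f₁ f₂ : holo n} (h : IsInner (f₁ * f₂))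
    (h₁ : ∀ z, ‖f₁.1 z‖ ≤ 1) (h₂ : ∀ z, ‖f₂.1 z‖ ≤ 1) : IsInner f₁ := by
  refine ⟨⟨1, h₁⟩, h.2.mono fun t ht => ?_⟩
  have hev : ∀ᶠ r : ℝ in 𝓝[<] 1, radialPoint t r ∈ polydisc n := by
    filter_upwards [Ioo_mem_nhdsLT (zero_lt_one (α := ℝ))] with r hr
    exact radialPoint_mem_polydisc t hr
  refine tendsto_of_tendsto_of_tendsto_of_le_of_le' ht tendsto_const_nhds ?_ ?_
  · filter_upwards [hev] with r hr
    simp only [extendByZero, dif_pos hr]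
    change ‖f₁.1 _ * f₂.1 _‖ ≤ _
    rw [norm_mul]
    exact mul_le_of_le_one_right (norm_nonneg _) (h₂ _)
  · filter_upwards [hev] with r hr
    simpa only [extendByZero, dif_pos hr] using h₁ _

/-- If `c * reflection q / q` were invertible, `reflection q` would be a constant multiple of `q`,
and each irreducible factor of `q` would be a common one. -/
theorem not_isUnit_of_eq_reflection_div {f : holo n} {c : ℂ} {q : MvPolynomial (Fin n) ℂ}
    (hq : ZeroFreeOnPolydisc q) (hqu : ¬ IsUnit q)
    (hcop : ∀ p : MvPolynomial (Fin n) ℂ, Irreducible p → p ∣ reflection q → ¬ p ∣ q)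
    (hf : ∀ z : polydisc n, f.1 z = c * (eval z.1 (reflection q) / eval z.1 q)) :
    ¬ IsUnit f := by
  intro hu
  have hr : ZeroFreeOnPolydisc (reflection q) := fun z hz h0 =>
    ne_zero_of_isUnit hu ⟨z, hz⟩ (by rw [hf]; simp [h0])
  obtain ⟨d, hd⟩ := hq.exists_reflection_eq_C_mul hr
  obtain ⟨p, hp, hpq⟩ := WfDvdMonoid.exists_irreducible_factor hqu hq.ne_zero
  exact hcop p hp (hd ▸ hpq.mul_left _) hpq

/-- Cancelling the greatest common divisor `d` of `Q` and `reflection Q` gives the reduced form.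
Since reflection exchanges `Q` and `reflection Q`, it maps `d` to a common divisor of both, hence to
a unimodular multiple of `d`. -/
theorem exists_isReducedForm {f : holo n} {Q : MvPolynomial (Fin n) ℂ}
    (hf : IsNonconstantFn f) (hQ : ZeroFreeOnPolydisc Q)
    (hfQ : ∀ z : polydisc n, f.1 z = eval z.1 (reflection Q) / eval z.1 Q) :
    ∃ (c : ℂ) (q : MvPolynomial (Fin n) ℂ), IsReducedForm f c q := by
  obtain ⟨q, p, d, hrel, hdq, hdp⟩ :=
    UniqueFactorizationMonoid.exists_reduced_factors Q hQ.ne_zero (reflection Q)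
  have hq : ZeroFreeOnPolydisc q := hQ.of_dvd ⟨d, by rw [← hdq, mul_comm]⟩
  have hd : ZeroFreeOnPolydisc d := hQ.of_dvd ⟨q, hdq.symm⟩
  have hp0 : p ≠ 0 := right_ne_zero_of_mul (hdp.trans_ne (reflection_ne_zero hQ.ne_zero))
  have h1 : reflection d * reflection q = d * p := by
    rw [← reflection_mul hd.ne_zero hq.ne_zero, hdq, hdp]
  have h2 : reflection d * reflection p = d * q := by
    rw [← reflection_mul hd.ne_zero hp0, hdp, reflection_reflection hQ.coeff_zero_ne_zero, hdq]
  have hdvd : reflection d ∣ d := by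
    have : NormalizedGCDMonoid (MvPolynomial (Fin n) ℂ) := Classical.choice inferInstance
    refine (dvd_gcd ⟨_, h2.symm⟩ ⟨_, h1.symm⟩).trans ((gcd_mul_left' d q p).dvd.trans ?_)
    exact (IsUnit.mul_right_dvd (hrel (gcd_dvd_left q p) (gcd_dvd_right q p))).2 dvd_rfl
  obtain ⟨e, he⟩ := hdvd
  have hrd0 : reflection d ≠ 0 := reflection_ne_zero hd.ne_zero
  have he0 : e ≠ 0 := right_ne_zero_of_mul (he.symm.trans_ne hd.ne_zero)
  -- `reflection d` has the same multidegree as `d`, so the cofactor is constant.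
  obtain ⟨e, rfl⟩ : ∃ c, e = C c := by
    have h3 := multidegree_mul hrd0 he0
    rw [← he, multidegree_reflection hd.coeff_zero_ne_zero, left_eq_add] at h3
    exact ⟨_, eq_C_of_multidegree_eq_zero h3⟩
  have he1 : e * starRingEnd ℂ e = 1 := by
    have h3 : reflection d = d * C (starRingEnd ℂ e) := by
      conv_lhs => rw [he, reflection_mul hrd0 he0, reflection_C,
        reflection_reflection hd.coeff_zero_ne_zero]
    have h4 : d * C (e * starRingEnd ℂ e) = d * C 1 := by
      rw [C_mul, mul_left_comm, ← h3, C_1, mul_one, mul_comm, ← he]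
    exact C_injective _ _ (mul_left_cancel₀ hd.ne_zero h4)
  have hen : ‖e‖ = 1 := by
    have h3 := congrArg norm he1
    rw [norm_mul, RCLike.norm_conj, norm_one] at h3
    nlinarith [norm_nonneg e]
  have hrq : reflection q = C e * p := by
    refine mul_left_cancel₀ hrd0 ?_
    rw [h1, ← mul_assoc, ← he]
  have hfq : ∀ z : polydisc n, f.1 z = e⁻¹ * (eval z.1 (reflection q) / eval z.1 q) := by
    intro z
    have hez : e ≠ 0 := left_ne_zero_of_mul_eq_one he1
    rw [hfQ, ← hdp, ← hdq, hrq, map_mul, map_mul, map_mul, eval_C,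
      mul_div_mul_left _ _ (hd z.1 z.2), mul_div_assoc, inv_mul_cancel_left₀ hez]
  refine ⟨e⁻¹, q, ?_, ?_, hq, hfq, fun s hs hs1 hs2 => ?_⟩
  · rw [norm_inv, hen, inv_one]
  · rintro ⟨b, rfl⟩
    refine hf ⟨e⁻¹ * (starRingEnd ℂ b / b), fun z => ?_⟩
    rw [hfq, reflection_C, eval_C, eval_C]
  · rw [hrq] at hs1
    have heu : IsUnit (C e : MvPolynomial (Fin n) ℂ) := isUnit_iff_exists_C.2 ⟨he0, e, rfl⟩
    exact hs.not_isUnit (hrel hs2 (heu.dvd_mul_left.1 hs1))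

/-- If the numerator `P₁` of `f₁ = P₁ / Q₁` takes up the factor `r` of the numerator of
`f₁ f₂ = c r / q`, then `f₂ = P₂ / Q₂` has no zeros. -/
theorem isUnit_of_dvd_numerator {f₂ : holo n} {c : ℂ} {q r P₁ P₂ Q₁ Q₂ : MvPolynomial (Fin n) ℂ}
    (hc : c ≠ 0) (hr : r ≠ 0) (hQ₁ : ZeroFreeOnPolydisc Q₁) (hQ₂ : ZeroFreeOnPolydisc Q₂)
    (h₂ : ∀ z : polydisc n, f₂.1 z * eval z.1 Q₂ = eval z.1 P₂)
    (h : P₁ * P₂ * q = C c * r * Q₁ * Q₂) (hdvd : r ∣ P₁) : IsUnit f₂ := by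
  obtain ⟨u, rfl⟩ := hdvd
  have h' : u * P₂ * q = C c * Q₁ * Q₂ := by
    refine mul_left_cancel₀ hr ?_
    linear_combination h
  refine isUnit_of_mul_eval_eq (P := P₂) (fun z hz h0 => ?_) h₂
  have h3 := congrArg (eval z) h'
  simp [h0, hc, hQ₁ z hz, hQ₂ z hz] at h3

/-- Written with zero-free denominators, one of the two factors has the irreducible polynomial
`reflection q` in its numerator; the numerator of the other one then divides a zero-free
polynomial. -/
theorem IsReducedForm.isUnit_or_isUnit {f f₁ f₂ : holo n} {c : ℂ} {q : MvPolynomial (Fin n) ℂ}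
    (hfq : IsReducedForm f c q) (hq : Irreducible q) (h₁ : IsRationalFn f₁) (h₂ : IsRationalFn f₂)
    (hf : f = f₁ * f₂) : IsUnit f₁ ∨ IsUnit f₂ := by
  obtain ⟨P₁, Q₁, hQ₁, hPQ₁⟩ := h₁.exists_zeroFree_denominator
  obtain ⟨P₂, Q₂, hQ₂, hPQ₂⟩ := h₂.exists_zeroFree_denominator
  have hc : c ≠ 0 := norm_ne_zero_iff.1 (by rw [hfq.norm_eq_one]; exact one_ne_zero)
  have hirr := irreducible_reflection hq hfq.zeroFree.coeff_zero_ne_zero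
  have key : P₁ * P₂ * q = C c * reflection q * Q₁ * Q₂ := by
    refine eq_of_eval_eq_on_polydisc fun z hz => ?_
    have h1 := hfq.eq_on ⟨z, hz⟩
    have h2 : f.1 ⟨z, hz⟩ = f₁.1 ⟨z, hz⟩ * f₂.1 ⟨z, hz⟩ := by
      rw [hf]
      rfl
    rw [h2, ← mul_div_assoc, eq_div_iff (hfq.zeroFree z hz)] at h1
    simp only [map_mul, eval_C]
    rw [← hPQ₁ ⟨z, hz⟩, ← hPQ₂ ⟨z, hz⟩]
    linear_combination eval z Q₁ * eval z Q₂ * h1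
  have hdvd : reflection q ∣ P₁ * P₂ * q := by
    rw [key]
    exact ⟨C c * Q₁ * Q₂, by ring⟩
  have hnq := hfq.no_common_factor _ hirr dvd_rfl
  rcases hirr.prime.dvd_or_dvd ((hirr.prime.dvd_or_dvd hdvd).resolve_right hnq) with h | h
  · exact Or.inr (isUnit_of_dvd_numerator hc hirr.ne_zero hQ₁ hQ₂ hPQ₂ key h)
  · have key' : P₂ * P₁ * q = C c * reflection q * Q₂ * Q₁ := by linear_combination key
    exact Or.inl (isUnit_of_dvd_numerator hc hirr.ne_zero hQ₂ hQ₁ hPQ₁ key' h)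

/-- A factorization of `q` splits `reflection q / q` into two quotients bounded by `1`. -/
theorem IsReducedForm.exists_factorization {f : holo n} {c : ℂ} {q₁ q₂ : MvPolynomial (Fin n) ℂ}
    (hf : IsInner f) (hfq : IsReducedForm f c (q₁ * q₂)) (hq₁ : ¬ IsUnit q₁) (hq₂ : ¬ IsUnit q₂) :
    ∃ f₁ f₂ : holo n, IsRationalInner f₁ ∧ IsRationalInner f₂ ∧
      ¬ IsUnit f₁ ∧ ¬ IsUnit f₂ ∧ f = f₁ * f₂ := by
  have hz₁ : ZeroFreeOnPolydisc q₁ := hfq.zeroFree.of_dvd (dvd_mul_right _ _)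
  have hz₂ : ZeroFreeOnPolydisc q₂ := hfq.zeroFree.of_dvd (dvd_mul_left _ _)
  have hr := reflection_mul hz₁.ne_zero hz₂.ne_zero
  set f₁ := quotientHolo (C c * reflection q₁) q₁ hz₁
  set f₂ := quotientHolo (reflection q₂) q₂ hz₂
  have e₁ : ∀ z : polydisc n, f₁.1 z = c * (eval z.1 (reflection q₁) / eval z.1 q₁) := fun z => by
    simp [f₁, quotientHolo, mul_div_assoc]
  have e₂ : ∀ z : polydisc n, f₂.1 z = 1 * (eval z.1 (reflection q₂) / eval z.1 q₂) := fun z => by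
    simp [f₂, quotientHolo]
  have b₁ : ∀ z, ‖f₁.1 z‖ ≤ 1 := fun z => by
    rw [e₁, norm_mul, hfq.norm_eq_one, one_mul, norm_div]
    exact div_le_one_of_le₀ (hz₁.norm_eval_reflection_le z.2) (norm_nonneg _)
  have b₂ : ∀ z, ‖f₂.1 z‖ ≤ 1 := fun z => by
    rw [e₂, one_mul, norm_div]
    exact div_le_one_of_le₀ (hz₂.norm_eval_reflection_le z.2) (norm_nonneg _)
  have hmul : f = f₁ * f₂ := by
    refine Subtype.ext (funext fun z => ?_)
    change f.1 z = f₁.1 z * f₂.1 z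
    rw [hfq.eq_on, e₁, e₂, hr, map_mul, map_mul, mul_div_mul_comm]
    ring
  refine ⟨f₁, f₂, ⟨isInner_left_of_mul (hmul ▸ hf) b₁ b₂, isRationalFn_quotientHolo _ _ _⟩,
    ⟨isInner_left_of_mul (mul_comm f₁ f₂ ▸ hmul ▸ hf) b₂ b₁, isRationalFn_quotientHolo _ _ _⟩,
    not_isUnit_of_eq_reflection_div hz₁ hq₁ (fun p hp h1 h2 => ?_) e₁,
    not_isUnit_of_eq_reflection_div hz₂ hq₂ (fun p hp h1 h2 => ?_) e₂, hmul⟩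
  · exact hfq.no_common_factor p hp (hr ▸ h1.mul_right _) (h2.mul_right _)
  · exact hfq.no_common_factor p hp (hr ▸ h1.mul_left _) (h2.mul_left _)

end Inner

theorem proposition2p2 (n : ℕ) (f : holo n) (Q : MvPolynomial (Fin n) ℂ)
    (hf : IsRationalInner f) (hf_nonconst : IsNonconstantFn f)
    (hQ_nonconst : IsNonconstantPoly Q) (hQ : ZeroFreeOnPolydisc Q)
    (hfQ : ∀ z : polydisc n, f.1 z = eval z.1 (reflection Q) / eval z.1 Q) :
    (∃ (c : ℂ) (q : MvPolynomial (Fin n) ℂ), IsReducedForm f c q) ∧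
    (∀ (c : ℂ) (q : MvPolynomial (Fin n) ℂ), IsReducedForm f c q →
      ((∃ f₁ f₂ : holo n, IsRationalInner f₁ ∧ IsRationalInner f₂ ∧
          ¬ IsUnit f₁ ∧ ¬ IsUnit f₂ ∧ f = f₁ * f₂) ↔
        IsReduciblePoly q)) := by
  refine ⟨exists_isReducedForm hf_nonconst hQ hfQ, fun c q hfq => ⟨?_, ?_⟩⟩
  · rintro ⟨f₁, f₂, h₁, h₂, hu₁, hu₂, hmul⟩
    by_contra hred
    have hirr : Irreducible q := by
      refine ⟨fun h => hfq.nonconstant (isUnit_iff_exists_C.1 h).2, fun a b hab => ?_⟩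
      by_contra! hab'
      exact hred ⟨a, b, hab'.1, hab'.2, hab⟩
    exact (hfq.isUnit_or_isUnit hirr h₁.2 h₂.2 hmul).elim hu₁ hu₂
  · rintro ⟨q₁, q₂, hu₁, hu₂, rfl⟩
    exact hfq.exists_factorization hf.1 hu₁ hu₂
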